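/- Let $q$ be a prime with $q\equiv 1 \pmod 3$ and let $z\in\mathbb{F}_q$ with $z\neq 0,1$. Consider the elliptic curves over $\mathbb{F}_q$ $$\mathcal{E}_{1,z}:\ Y^2=Z^3+3(2+z)Z^2+3(3-z)(1-z)Z+z(1-z)^2,$$ $$\mathcal{E}_{2,z}:\ V^2=U^3+3(3-z)U^2+3(2+z)zU+(1-z)z^2.$$ Then $$\#\mathcal{E}_{1,z}(\mathbb{F}_q)=\#\mathcal{E}_{2,z}(\mathbb{F}_q),$$ where $\#\mathcal{E}(\mathbb{F}_q)$ denotes the number of $\mathbb{F}_q$-rational points of $\mathcal{E}$, including the point at infinity. -/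

import Mathlib

/-- The curve `Y² = Z³ + 3(2+z)Z² + 3(3-z)(1-z)Z + z(1-z)²`. -/
def curveE1 {F : Type*} [Field F] (z : F) : WeierstrassCurve F where
  a₁ := 0
  a₂ := 3 * (2 + z)
  a₃ := 0
  a₄ := 3 * (3 - z) * (1 - z)
  a₆ := z * (1 - z) ^ 2

/-- The curve `V² = U³ + 3(3-z)U² + 3(2+z)zU + (1-z)z²`. -/
def curveE2 {F : Type*} [Field F] (z : F) : WeierstrassCurve F where
  a₁ := 0
  a₂ := 3 * (3 - z)
  a₃ := 0
  a₄ := 3 * (2 + z) * z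
  a₆ := (1 - z) * z ^ 2

/-- The number of `F`-rational points, the point at infinity included. `WeierstrassCurve.Affine.Point`
consists of the point at infinity and of the nonsingular affine points, which are all the affine
points when the discriminant is nonzero, see `curveE1_Δ` and `curveE2_Δ`. -/
noncomputable def numPoints {F : Type*} [Field F] (W : WeierstrassCurve F) : ℕ :=
  Nat.card W.toAffine.Point

theorem curveE1_Δ {F : Type*} [Field F] (z : F) :
    (curveE1 z).Δ = 110592 * z * (1 - z) ^ 3 := by
  simp only [curveE1, WeierstrassCurve.Δ, WeierstrassCurve.b₂, WeierstrassCurve.b₄,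
    WeierstrassCurve.b₆, WeierstrassCurve.b₈]
  ring

theorem curveE2_Δ {F : Type*} [Field F] (z : F) :
    (curveE2 z).Δ = 110592 * z ^ 3 * (1 - z) := by
  simp only [curveE2, WeierstrassCurve.Δ, WeierstrassCurve.b₂, WeierstrassCurve.b₄,
    WeierstrassCurve.b₆, WeierstrassCurve.b₈]
  ring

/-! Since `curveE1 z` is `curveE2 (1 - z)`, the claim is a symmetry under `c ↦ 1 - c`; the two
curves are 3-isogenous. In the form `(y - 3x - c)(y + 3x + c) = (x - c)³`, the cubic residue class
of `y - 3x - c` is a homomorphism to the cube roots of unity (`descentChar_add`), so its kernel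
contains at least a third of the points (`card_point_le_three_mul`). Each point of the kernel has
three preimages on `curveE2 (1 - c)` (`exists_three_threeIsogeny_preimages`). Hence `curveE2 c` has
at most as many points as `curveE2 (1 - c)`, and exchanging `c` and `1 - c` gives equality. That the
isogeny is a homomorphism is never needed. -/

open WeierstrassCurve WeierstrassCurve.Affine

/-! ### The 3-descent map and its cubic residue character -/

section CubicClass

variable {F : Type*} [Field F] {c : F}

theorem curveE2_equation_iff (c x y : F) :
    (curveE2 c).toAffine.Equation x y ↔
      (y - 3 * x - c) * (y + 3 * x + c) = (x - c) ^ 3 := by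
  rw [equation_iff]
  simp only [curveE2]
  constructor <;> intro h <;> linear_combination h

theorem curveE2_Δ_ne_zero (h2 : (2 : F) ≠ 0) (h3 : (3 : F) ≠ 0) (hc0 : c ≠ 0) (hc1 : c ≠ 1) :
    (curveE2 c).Δ ≠ 0 := by
  rw [curveE2_Δ, show (110592 : F) = 2 ^ 12 * 3 ^ 3 by norm_num]
  have : 1 - c ≠ 0 := sub_ne_zero.mpr hc1.symm
  positivity

theorem curveE2_nonsingular (h2 : (2 : F) ≠ 0) (h3 : (3 : F) ≠ 0) (hc0 : c ≠ 0) (hc1 : c ≠ 1)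
    {x y : F} (h : (y - 3 * x - c) * (y + 3 * x + c) = (x - c) ^ 3) :
    (curveE2 c).toAffine.Nonsingular x y :=
  (equation_iff_nonsingular_of_Δ_ne_zero (curveE2_Δ_ne_zero h2 h3 hc0 hc1)).mp
    ((curveE2_equation_iff c x y).mpr h)

/-- The equation `y - 3x - c` of the inflectional tangent at `(c, 4c)`. -/
def tangentMinus : (curveE2 c).toAffine.Point → F
  | .zero => 1
  | .some x y _ => y - 3 * x - c

/-- The equation `y + 3x + c` of the inflectional tangent at `(c, -4c)`. -/
def tangentPlus : (curveE2 c).toAffine.Point → F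
  | .zero => 1
  | .some x y _ => y + 3 * x + c

theorem tangent_mul_isCube (P : (curveE2 c).toAffine.Point) :
    ∃ r, tangentMinus P * tangentPlus P = r ^ 3 := by
  rcases P with _ | ⟨x, y, h⟩
  · exact ⟨1, by simp [tangentMinus, tangentPlus]⟩
  · exact ⟨x - c, (curveE2_equation_iff c x y).mp h.1⟩

theorem add_eq_zero_of_tangent_eq_zero [DecidableEq F] {P Q : (curveE2 c).toAffine.Point}
    (hP : tangentMinus P = 0) (hQ : tangentPlus Q = 0) : P + Q = 0 := by
  rcases P with _ | ⟨x, y, h⟩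
  · simp [tangentMinus] at hP
  rcases Q with _ | ⟨x', y', h'⟩
  · simp [tangentPlus] at hQ
  have e := (curveE2_equation_iff c x y).mp h.1
  have e' := (curveE2_equation_iff c x' y').mp h'.1
  simp only [tangentMinus] at hP
  simp only [tangentPlus] at hQ
  rw [hP, zero_mul, eq_comm, pow_eq_zero_iff three_ne_zero, sub_eq_zero] at e
  rw [hQ, mul_zero, eq_comm, pow_eq_zero_iff three_ne_zero, sub_eq_zero] at e'
  subst e e'
  refine Point.add_of_Y_eq rfl ?_
  simp only [negY, curveE2]
  linear_combination hP + hQ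

theorem tangentPlus_ne_zero_of_tangentMinus_eq_zero (h2 : (2 : F) ≠ 0) (hc0 : c ≠ 0)
    {P : (curveE2 c).toAffine.Point} (hP : tangentMinus P = 0) : tangentPlus P ≠ 0 := by
  rcases P with _ | ⟨x, y, h⟩
  · simp [tangentMinus] at hP
  have e := (curveE2_equation_iff c x y).mp h.1
  simp only [tangentMinus] at hP
  simp only [tangentPlus]
  rw [hP, zero_mul, eq_comm, pow_eq_zero_iff three_ne_zero, sub_eq_zero] at e
  subst e
  rw [show y + 3 * x + x = 2 ^ 3 * x by linear_combination hP]
  positivity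

theorem tangentMinus_neg {P : (curveE2 c).toAffine.Point} (hP : P ≠ 0) :
    tangentMinus (-P) = -tangentPlus P := by
  rcases P with _ | ⟨x, y, h⟩
  · exact absurd rfl hP
  · change -y - 0 * x - 0 - 3 * x - c = -(y + 3 * x + c)
    ring

theorem tangentPlus_neg {P : (curveE2 c).toAffine.Point} (hP : P ≠ 0) :
    tangentPlus (-P) = -tangentMinus P := by
  rcases P with _ | ⟨x, y, h⟩
  · exact absurd rfl hP
  · change -y - 0 * x - 0 + 3 * x + c = -(y - 3 * x - c)
    ring

theorem cube_pow_eq_one {k : ℕ} (hk : ∀ a : F, a ≠ 0 → a ^ (3 * k) = 1) {a r : F} (ha : a ≠ 0)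
    (h : a = r ^ 3) : a ^ k = 1 := by
  rw [h, ← pow_mul]
  exact hk r (by rintro rfl; simp [h] at ha)

theorem neg_one_pow_eq_one {k : ℕ} (hk : ∀ a : F, a ≠ 0 → a ^ (3 * k) = 1) : (-1 : F) ^ k = 1 :=
  cube_pow_eq_one hk (neg_ne_zero.mpr one_ne_zero) (r := -1) (by ring)

variable [DecidableEq F]

/-- On the line `y = l x + m` through the three points, `(x - c)³ - (y - 3x - c)(y + 3x + c)` equals
`∏ (x - xᵢ)`. Evaluating where `(l - 3) x + m - c` vanishes, and clearing `(l - 3)³`, leaves a cube.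
-/
theorem tangentMinus_mul_isCube {P Q R : (curveE2 c).toAffine.Point} (hP : P ≠ 0) (hQ : Q ≠ 0)
    (hR : R ≠ 0) (h : P + Q + R = 0) :
    ∃ r, tangentMinus P * tangentMinus Q * tangentMinus R = r ^ 3 := by
  obtain rfl : R = -(P + Q) := (neg_eq_of_add_eq_zero_right h).symm
  rcases P with _ | ⟨x₁, y₁, h₁⟩
  · exact absurd rfl hP
  rcases Q with _ | ⟨x₂, y₂, h₂⟩
  · exact absurd rfl hQ
  have hxy : ¬(x₁ = x₂ ∧ y₁ = (curveE2 c).toAffine.negY x₂ y₂) := fun H =>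
    hR (by rw [Point.add_of_Y_eq H.1 H.2, neg_zero])
  have key := addPolynomial_slope h₁.1 h₂.1 hxy
  rw [addPolynomial_eq, neg_inj, Cubic.prod_X_sub_C_eq, Cubic.toPoly_injective,
    Cubic.mk.injEq] at key
  rw [Point.add_some hxy, Point.neg_some]
  have e := (equation_iff ..).mp h₂.1
  have hy : y₂ = (curveE2 c).toAffine.slope x₁ x₂ y₁ y₂ * (x₂ - x₁) + y₁ := by
    by_cases hx : x₁ = x₂
    · have hy : y₁ ≠ (curveE2 c).toAffine.negY x₂ y₂ := fun H => hxy ⟨hx, H⟩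
      rw [Y_eq_of_Y_ne h₁.1 h₂.1 hx hy, hx]
      ring
    · rw [slope_of_X_ne hx]
      have := sub_ne_zero.mpr hx
      field_simp
      ring
  simp only [tangentMinus, negY, addY, negAddY]
  generalize (curveE2 c).toAffine.slope x₁ x₂ y₁ y₂ = l at *
  generalize (curveE2 c).toAffine.addX x₁ x₂ l = x₃ at *
  obtain ⟨-, k1, k2, k3⟩ := key
  simp only [curveE2] at k1 k2 k3 ⊢
  -- The tangent form `y - 3x - c` at the point of the line with `x = c`.
  refine ⟨l * (c - x₁) + y₁ - 4 * c, ?_⟩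
  rw [hy]
  linear_combination (l - 3) * (y₁ - l * x₁ - c) ^ 2 * k1
    - (l - 3) ^ 2 * (y₁ - l * x₁ - c) * k2 + (l - 3) ^ 3 * k3

theorem tangentPlus_mul_isCube {P Q R : (curveE2 c).toAffine.Point} (hP : P ≠ 0) (hQ : Q ≠ 0)
    (hR : R ≠ 0) (h : P + Q + R = 0) :
    ∃ r, tangentPlus P * tangentPlus Q * tangentPlus R = r ^ 3 := by
  obtain ⟨r, hr⟩ := tangentMinus_mul_isCube (neg_ne_zero.mpr hP) (neg_ne_zero.mpr hQ)
    (neg_ne_zero.mpr hR) (by rw [← neg_add, ← neg_add, h, neg_zero])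
  rw [tangentMinus_neg hP, tangentMinus_neg hQ, tangentMinus_neg hR] at hr
  exact ⟨-r, by linear_combination -hr⟩

/-- The `k`-th power of a representative of the class of `P` under the `3`-descent map. -/
def descentChar (k : ℕ) (P : (curveE2 c).toAffine.Point) : F :=
  -- The product of the two forms is a cube, so modulo cubes `tangentMinus` is the inverse,
  -- equivalently the square, of `tangentPlus`.
  if tangentMinus P = 0 then tangentPlus P ^ (2 * k) else tangentMinus P ^ k

variable {k : ℕ}

theorem descentChar_zero : descentChar k (0 : (curveE2 c).toAffine.Point) = 1 := by
  have : tangentMinus (0 : (curveE2 c).toAffine.Point) = 1 := rfl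
  simp [descentChar, this]

theorem descentChar_ne_zero (h2 : (2 : F) ≠ 0) (hc0 : c ≠ 0)
    (P : (curveE2 c).toAffine.Point) : descentChar k P ≠ 0 := by
  unfold descentChar
  split_ifs with h
  · exact pow_ne_zero _ (tangentPlus_ne_zero_of_tangentMinus_eq_zero h2 hc0 h)
  · exact pow_ne_zero _ h

theorem descentChar_pow_three (hk : ∀ a : F, a ≠ 0 → a ^ (3 * k) = 1) (h2 : (2 : F) ≠ 0)
    (hc0 : c ≠ 0) (P : (curveE2 c).toAffine.Point) : descentChar k P ^ 3 = 1 := by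
  unfold descentChar
  split_ifs with h
  · rw [← pow_mul, show 2 * k * 3 = 3 * k * 2 by ring, pow_mul,
      hk _ (tangentPlus_ne_zero_of_tangentMinus_eq_zero h2 hc0 h), one_pow]
  · rw [← pow_mul, mul_comm k, hk _ h]

theorem descentChar_mul_tangentPlus_pow (hk : ∀ a : F, a ≠ 0 → a ^ (3 * k) = 1)
    {P : (curveE2 c).toAffine.Point} (hP : tangentPlus P ≠ 0) :
    descentChar k P * tangentPlus P ^ k = 1 := by
  unfold descentChar
  split_ifs with h
  · rw [← pow_add, show 2 * k + k = 3 * k by ring, hk _ hP]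
  · obtain ⟨r, hr⟩ := tangent_mul_isCube P
    rw [← mul_pow]
    exact cube_pow_eq_one hk (mul_ne_zero h hP) hr

theorem descentChar_mul_mul (hk : ∀ a : F, a ≠ 0 → a ^ (3 * k) = 1) (h2 : (2 : F) ≠ 0)
    (hc0 : c ≠ 0) {P Q R : (curveE2 c).toAffine.Point} (hP : P ≠ 0) (hQ : Q ≠ 0)
    (hR : R ≠ 0) (h : P + Q + R = 0) :
    descentChar k P * descentChar k Q * descentChar k R = 1 := by
  by_cases hv : tangentMinus P ≠ 0 ∧ tangentMinus Q ≠ 0 ∧ tangentMinus R ≠ 0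
  · obtain ⟨p, q, r⟩ := hv
    obtain ⟨s, hs⟩ := tangentMinus_mul_isCube hP hQ hR h
    rw [descentChar, descentChar, descentChar, if_neg p, if_neg q, if_neg r, ← mul_pow, ← mul_pow]
    exact cube_pow_eq_one hk (mul_ne_zero (mul_ne_zero p q) r) hs
  by_cases hu : tangentPlus P ≠ 0 ∧ tangentPlus Q ≠ 0 ∧ tangentPlus R ≠ 0
  · obtain ⟨p, q, r⟩ := hu
    obtain ⟨s, hs⟩ := tangentPlus_mul_isCube hP hQ hR h
    have hs' := cube_pow_eq_one hk (mul_ne_zero (mul_ne_zero p q) r) hs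
    have p' := descentChar_mul_tangentPlus_pow hk p
    have q' := descentChar_mul_tangentPlus_pow hk q
    have r' := descentChar_mul_tangentPlus_pow hk r
    rw [mul_pow, mul_pow] at hs'
    calc _ = descentChar k P * descentChar k Q * descentChar k R *
          (tangentPlus P ^ k * tangentPlus Q ^ k * tangentPlus R ^ k) := by rw [hs', mul_one]
      _ = (descentChar k P * tangentPlus P ^ k) * (descentChar k Q * tangentPlus Q ^ k) *
          (descentChar k R * tangentPlus R ^ k) := by ring
      _ = 1 := by rw [p', q', r', one_mul, one_mul]
  -- Otherwise `(c, 4c)` and `(c, -4c)` both occur among the three points; they are opposite, so the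
  -- third point would be zero.
  exfalso
  have hPQ : P + Q ≠ 0 := fun H => hR (by rwa [H, zero_add] at h)
  have hPR : P + R ≠ 0 := fun H => hQ (by rwa [add_right_comm, H, zero_add] at h)
  have hQR : Q + R ≠ 0 := fun H => hP (by rwa [add_assoc, H, add_zero] at h)
  have key {A B : (curveE2 c).toAffine.Point} (hA : tangentMinus A = 0)
    (hB : tangentPlus B = 0) : A + B = 0 :=
    add_eq_zero_of_tangent_eq_zero hA hB
  have self {A : (curveE2 c).toAffine.Point} (hA : tangentMinus A = 0)
    (hB : tangentPlus A = 0) : False :=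
    tangentPlus_ne_zero_of_tangentMinus_eq_zero h2 hc0 hA hB
  have hQP := add_comm P Q ▸ hPQ
  have hRP := add_comm P R ▸ hPR
  have hRQ := add_comm Q R ▸ hQR
  have hv' : tangentMinus P = 0 ∨ tangentMinus Q = 0 ∨ tangentMinus R = 0 := by tauto
  have hu' : tangentPlus P = 0 ∨ tangentPlus Q = 0 ∨ tangentPlus R = 0 := by tauto
  rcases hv' with a | a | a <;> rcases hu' with b | b | b <;>
    first
      | exact self a b
      | exact absurd (key a b) ‹_›

theorem descentChar_mul_neg (hk : ∀ a : F, a ≠ 0 → a ^ (3 * k) = 1) (h2 : (2 : F) ≠ 0)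
    (hc0 : c ≠ 0) (P : (curveE2 c).toAffine.Point) :
    descentChar k P * descentChar k (-P) = 1 := by
  rcases eq_or_ne P 0 with rfl | hP
  · rw [neg_zero, descentChar_zero, one_mul]
  have main {P : (curveE2 c).toAffine.Point} (hP : P ≠ 0) (h : tangentPlus P ≠ 0) :
      descentChar k P * descentChar k (-P) = 1 := by
    have h' : tangentMinus (-P) ≠ 0 := by rw [tangentMinus_neg hP]; exact neg_ne_zero.mpr h
    rw [← descentChar_mul_tangentPlus_pow hk h, descentChar.eq_1 k (-P), if_neg h',
      tangentMinus_neg hP, neg_pow, neg_one_pow_eq_one hk, one_mul]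
  by_cases h : tangentPlus P = 0
  · have h' : tangentMinus P ≠ 0 := fun H =>
      tangentPlus_ne_zero_of_tangentMinus_eq_zero h2 hc0 H h
    have := main (neg_ne_zero.mpr hP) (by rw [tangentPlus_neg hP]; exact neg_ne_zero.mpr h')
    rwa [neg_neg, mul_comm] at this
  · exact main hP h

theorem descentChar_add (hk : ∀ a : F, a ≠ 0 → a ^ (3 * k) = 1) (h2 : (2 : F) ≠ 0)
    (hc0 : c ≠ 0) (P Q : (curveE2 c).toAffine.Point) :
    descentChar k (P + Q) = descentChar k P * descentChar k Q := by
  rcases eq_or_ne P 0 with rfl | hP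
  · rw [zero_add, descentChar_zero, one_mul]
  rcases eq_or_ne Q 0 with rfl | hQ
  · rw [add_zero, descentChar_zero, mul_one]
  rcases eq_or_ne (P + Q) 0 with hR | hR
  · obtain rfl : Q = -P := (neg_eq_of_add_eq_zero_right hR).symm
    rw [hR, descentChar_zero, descentChar_mul_neg hk h2 hc0]
  have h1 := descentChar_mul_mul hk h2 hc0 hP hQ (neg_ne_zero.mpr hR) (add_neg_cancel _)
  have h3 := descentChar_mul_neg hk h2 hc0 (P + Q)
  exact mul_right_cancel₀ (descentChar_ne_zero h2 hc0 (-(P + Q))) (h3.trans h1.symm)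

/-- The `3`-descent map composed with the cubic residue character, as a group homomorphism. -/
noncomputable def descentHom (hk : ∀ a : F, a ≠ 0 → a ^ (3 * k) = 1) (h2 : (2 : F) ≠ 0)
    (hc0 : c ≠ 0) : Multiplicative (curveE2 c).toAffine.Point →* Fˣ :=
  MonoidHom.toHomUnits
    { toFun := fun P => descentChar k P.toAdd
      map_one' := descentChar_zero
      map_mul' := fun P Q => descentChar_add hk h2 hc0 P.toAdd Q.toAdd }

theorem card_point_le_three_mul (hk : ∀ a : F, a ≠ 0 → a ^ (3 * k) = 1) (h2 : (2 : F) ≠ 0)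
    (hc0 : c ≠ 0) : Nat.card (curveE2 c).toAffine.Point ≤
      Nat.card {P : (curveE2 c).toAffine.Point // descentChar k P = 1} * 3 := by
  let f := descentHom (k := k) hk h2 hc0
  have hf (P : Multiplicative (curveE2 c).toAffine.Point) :
      (f P : F) = descentChar k P.toAdd := rfl
  have h1 : Nat.card (curveE2 c).toAffine.Point = Nat.card f.ker * Nat.card f.range := by
    rw [← Subgroup.index_ker, Subgroup.card_mul_index]
    exact Nat.card_congr Multiplicative.ofAdd
  have h3 : Nat.card f.ker = Nat.card {P : (curveE2 c).toAffine.Point // descentChar k P = 1} :=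
    Nat.card_congr (Equiv.subtypeEquiv Multiplicative.toAdd fun P => by
      rw [MonoidHom.mem_ker, Units.ext_iff, hf, Units.val_one])
  have h4 : f.range ≤ rootsOfUnity 3 F := by
    rintro _ ⟨P, rfl⟩
    rw [mem_rootsOfUnity, Units.ext_iff, Units.val_pow_eq_pow_val, hf, Units.val_one]
    exact descentChar_pow_three hk h2 hc0 _
  rw [h1, h3]
  exact Nat.mul_le_mul_left _
    ((Subgroup.card_le_of_le h4).trans (card_rootsOfUnity F 3))

end CubicClass

/-! ### The 3-isogeny through the cubic `t³ - w³ = 6wt + 8c` -/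

section HessianCover

variable {F : Type*} [Field F] {c ω : F} {k : ℕ}

/-- Trivial class means `y - 3x - c = w³`. With `x - c = w t` the curve equation gives `y + 3x + c =
t³`, and the difference of the two is the cubic. At `(c, 4c)`, take `w = 0`. -/
theorem exists_hessian_of_descentChar_eq_one [DecidableEq F]
    (hk : ∀ a : F, a ≠ 0 → a ^ (3 * k) = 1)
    (hcube : ∀ a : F, a ≠ 0 → a ^ k = 1 → ∃ r, r ^ 3 = a) (h2 : (2 : F) ≠ 0) (hc0 : c ≠ 0)
    {x y : F} (h : (curveE2 c).toAffine.Nonsingular x y)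
    (hP : descentChar k (.some x y h) = 1) :
    ∃ t w, t ^ 3 - w ^ 3 = 6 * w * t + 8 * c ∧ x = w * t + c ∧
      y = w ^ 3 + 3 * (w * t + c) + c := by
  have e := (curveE2_equation_iff c x y).mp h.1
  by_cases hv : tangentMinus (.some x y h) = 0
  · have hu := tangentPlus_ne_zero_of_tangentMinus_eq_zero h2 hc0 hv
    rw [descentChar, if_pos hv] at hP
    have hu3 := hk _ hu
    rw [show 3 * k = 2 * k + k by ring, pow_add, hP, one_mul] at hu3
    obtain ⟨t, ht⟩ := hcube _ hu hu3
    simp only [tangentMinus] at hv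
    simp only [tangentPlus] at ht
    rw [hv, zero_mul, eq_comm, pow_eq_zero_iff three_ne_zero, sub_eq_zero] at e
    exact ⟨t, 0, by linear_combination ht + hv + 6 * e, by rw [e]; ring,
      by linear_combination hv + 3 * e⟩
  · rw [descentChar, if_neg hv] at hP
    obtain ⟨w, hw⟩ := hcube _ hv hP
    have hw0 : w ≠ 0 := by rintro rfl; exact hv (by rw [← hw]; ring)
    simp only [tangentMinus] at hw
    obtain ⟨t, ht⟩ : ∃ t, x - c = w * t := ⟨(x - c) / w, by field_simp⟩
    refine ⟨t, w, ?_, by linear_combination ht, by linear_combination 3 * ht - hw⟩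
    apply mul_left_cancel₀ (pow_ne_zero 3 hw0)
    have hy : y = w ^ 3 + 3 * x + c := by linear_combination -hw
    obtain rfl : x = w * t + c := by linear_combination ht
    rw [hy] at e
    linear_combination -e

/-- As `t³ - w³ - 6wt - 8` splits into three lines `A`, `B`, `C` over `ω`, the cubic reads `A B C =
-8(1 - c)`, with `A + B + C = -6`. Setting `s = 8(1 - c) / B`, the point has `x - (1 - c) = s` and
tangent forms `s A` and `-s C`. The last two equations recover `t` and `w` from `A`, `B`, `C` by a
discrete Fourier transform. -/
theorem exists_point_of_hessian (h2 : (2 : F) ≠ 0) (hω : ω ^ 2 + ω + 1 = 0) (hc1 : c ≠ 1) {t w : F}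
    (h : t ^ 3 - w ^ 3 = 6 * w * t + 8 * c) :
    ∃ x y, (y - 3 * x - (1 - c)) * (y + 3 * x + (1 - c)) = (x - (1 - c)) ^ 3 ∧ x ≠ 1 - c ∧
      3 * (x - (1 - c)) * t = (y - 3 * x - (1 - c)) + 8 * ω ^ 2 * (1 - c)
        - ω * (y + 3 * x + (1 - c)) ∧
      3 * (x - (1 - c)) * w = -((y - 3 * x - (1 - c)) + 8 * ω * (1 - c)
        - ω ^ 2 * (y + 3 * x + (1 - c))) := by
  have hω2 : ω ^ 2 = -ω - 1 := by linear_combination hω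
  have hprod : (t - w - 2) * (ω * t - ω ^ 2 * w - 2) * (ω ^ 2 * t - ω * w - 2) =
      -(8 * (1 - c)) := by
    rw [hω2]
    linear_combination h + (4 * t * w + t * w ^ 2 + 2 * t ^ 2 - t ^ 2 * w + 2 * w ^ 2 + w ^ 3
      - t ^ 3) * hω
  have hd : 8 * (1 - c) ≠ 0 := by
    have := sub_ne_zero.mpr hc1.symm
    rw [show (8 : F) = 2 ^ 3 by norm_num]
    positivity
  have hβ : ω * t - ω ^ 2 * w - 2 ≠ 0 := by
    intro H
    rw [H] at hprod
    exact hd (by linear_combination hprod)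
  obtain ⟨s, hs⟩ : ∃ s, s * (ω * t - ω ^ 2 * w - 2) = 8 * (1 - c) :=
    ⟨8 * (1 - c) / (ω * t - ω ^ 2 * w - 2), div_mul_cancel₀ _ hβ⟩
  have hs0 : s ≠ 0 := by
    rintro rfl
    exact hd (by linear_combination -hs)
  have hAC : (t - w - 2) * (ω ^ 2 * t - ω * w - 2) = -s :=
    mul_right_cancel₀ hβ (by linear_combination hprod + hs)
  refine ⟨s + (1 - c), s * (t - w - 2) + 3 * (s + (1 - c)) + (1 - c), ?_, by simpa using hs0,
    ?_, ?_⟩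
  · linear_combination s ^ 2 * (t - w - 2) * (t - w) * hω - s * (t - w - 2) * hs - s ^ 2 * hAC
  · linear_combination -s * (2 * t * (ω - 1) - w * (1 - ω + ω ^ 2) - 2 - ω * (t - w)) * hω
      - (ω - ω ^ 2) * hs
  · linear_combination s * (t * (1 - ω + ω ^ 2) - 2 * w * (ω - 1) - 2 - ω ^ 2 * (t - w)) * hω
      + (ω ^ 2 - ω) * hs

/-- The coordinate `t` on `curveE2 (1 - c)` as a model of the cubic `t³ - w³ = 6wt + 8c`. -/
def hessianT (ω c x y : F) : F :=
  ((y - 3 * x - (1 - c)) + 8 * ω ^ 2 * (1 - c) - ω * (y + 3 * x + (1 - c))) /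
    (3 * (x - (1 - c)))

/-- The coordinate `w` on `curveE2 (1 - c)` as a model of the cubic `t³ - w³ = 6wt + 8c`. -/
def hessianW (ω c x y : F) : F :=
  -((y - 3 * x - (1 - c)) + 8 * ω * (1 - c) - ω ^ 2 * (y + 3 * x + (1 - c))) /
    (3 * (x - (1 - c)))

open Classical in
/-- The `3`-isogeny from `curveE2 (1 - c)` to `curveE2 c`. -/
noncomputable def threeIsogeny (ω c : F) :
    (curveE2 (1 - c)).toAffine.Point → (curveE2 c).toAffine.Point
  | .zero => 0
  | .some x y _ =>
    if x = 1 - c then 0 else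
      if h : (curveE2 c).toAffine.Nonsingular (hessianW ω c x y * hessianT ω c x y + c)
        (hessianW ω c x y ^ 3 + 3 * (hessianW ω c x y * hessianT ω c x y + c) + c)
      then .some _ _ h else 0

theorem exists_threeIsogeny_preimage (h2 : (2 : F) ≠ 0) (h3 : (3 : F) ≠ 0)
    (hω : ω ^ 2 + ω + 1 = 0) (hc0 : c ≠ 0) (hc1 : c ≠ 1) {t w : F}
    (h : t ^ 3 - w ^ 3 = 6 * w * t + 8 * c)
    (hns : (curveE2 c).toAffine.Nonsingular (w * t + c) (w ^ 3 + 3 * (w * t + c) + c)) :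
    ∃ x y, ∃ hxy : (curveE2 (1 - c)).toAffine.Nonsingular x y,
      threeIsogeny ω c (.some x y hxy) = .some _ _ hns ∧
      hessianT ω c x y = t ∧ hessianW ω c x y = w := by
  obtain ⟨x, y, e, hx, ht, hw⟩ := exists_point_of_hessian h2 hω hc1 h
  have hx' : 3 * (x - (1 - c)) ≠ 0 := mul_ne_zero h3 (sub_ne_zero.mpr hx)
  obtain rfl : hessianT ω c x y = t := by
    rw [hessianT, div_eq_iff hx']
    linear_combination -ht
  obtain rfl : hessianW ω c x y = w := by
    rw [hessianW, div_eq_iff hx']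
    linear_combination -hw
  refine ⟨x, y, curveE2_nonsingular h2 h3 (sub_ne_zero.mpr hc1.symm) (by simpa using hc0) e,
    ?_, rfl, rfl⟩
  simp only [threeIsogeny]
  rw [if_neg hx, dif_pos hns]

/-- Over an affine point the fibre comes from `(t, w) ↦ (ω²ⁱ t, ωⁱ w)`, which preserves `w t`, `w³`
and the cubic. -/
theorem exists_three_threeIsogeny_preimages [DecidableEq F]
    (hk : ∀ a : F, a ≠ 0 → a ^ (3 * k) = 1)
    (hcube : ∀ a : F, a ≠ 0 → a ^ k = 1 → ∃ r, r ^ 3 = a) (h2 : (2 : F) ≠ 0) (h3 : (3 : F) ≠ 0)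
    (hω : ω ^ 2 + ω + 1 = 0) (hc0 : c ≠ 0) (hc1 : c ≠ 1) (P : (curveE2 c).toAffine.Point)
    (hP : descentChar k P = 1) :
    ∃ e : Fin 3 → (curveE2 (1 - c)).toAffine.Point,
      Function.Injective e ∧ ∀ i, threeIsogeny ω c (e i) = P := by
  have hd : 1 - c ≠ 0 := sub_ne_zero.mpr hc1.symm
  have hd1 : 1 - c ≠ 1 := by simpa using hc0
  rcases P with _ | ⟨x, y, hxy⟩
  · have n1 : (curveE2 (1 - c)).toAffine.Nonsingular (1 - c) (4 * (1 - c)) :=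
      curveE2_nonsingular h2 h3 hd hd1 (by ring)
    have n2 : (curveE2 (1 - c)).toAffine.Nonsingular (1 - c) (-(4 * (1 - c))) :=
      curveE2_nonsingular h2 h3 hd hd1 (by ring)
    have n12 : 4 * (1 - c) ≠ -(4 * (1 - c)) := by
      intro H
      have : (2 : F) ^ 3 * (1 - c) ≠ 0 := by positivity
      exact this (by linear_combination H)
    refine ⟨![0, .some _ _ n1, .some _ _ n2], ?_, ?_⟩
    · intro i j hij
      fin_cases i <;> fin_cases j <;>
        simp_all [Point.some_ne_zero, (Point.some_ne_zero _).symm, n12.symm]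
    · intro i
      fin_cases i
      · rfl
      · simp [threeIsogeny]; rfl
      · simp [threeIsogeny]; rfl
  · obtain ⟨t, w, htw, rfl, rfl⟩ :=
      exists_hessian_of_descentChar_eq_one hk hcube h2 hc0 hxy hP
    have hω3 : ω ^ 3 = 1 := by linear_combination (ω - 1) * hω
    have hi (i : ℕ) : (ω ^ i) ^ 3 = 1 := by rw [← pow_mul, mul_comm, pow_mul, hω3, one_pow]
    have key (i : Fin 3) : ∃ Q : (curveE2 (1 - c)).toAffine.Point,
        threeIsogeny ω c Q = .some _ _ hxy ∧ ∃ x y h, Q = .some x y h ∧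
          hessianT ω c x y = (ω ^ (i : ℕ)) ^ 2 * t ∧ hessianW ω c x y = ω ^ (i : ℕ) * w := by
      have e1 : ω ^ (i : ℕ) * w * ((ω ^ (i : ℕ)) ^ 2 * t) = w * t := by
        linear_combination w * t * hi i
      have e2 : (ω ^ (i : ℕ) * w) ^ 3 = w ^ 3 := by
        linear_combination w ^ 3 * hi i
      obtain ⟨x, y, h, hQ, hT, hW⟩ := exists_threeIsogeny_preimage
        (t := (ω ^ (i : ℕ)) ^ 2 * t) (w := ω ^ (i : ℕ) * w) h2 h3 hω hc0 hc1
        (by linear_combination htw + (t ^ 3 * ((ω ^ (i : ℕ)) ^ 3 + 1) - w ^ 3 - 6 * w * t) * hi i)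
        (by rwa [e2, e1])
      refine ⟨_, ?_, x, y, h, rfl, hT, hW⟩
      rw [hQ]
      simp only [e1, e2]
    choose e he x' y' h' heq hT hW using key
    refine ⟨e, fun i j hij => ?_, he⟩
    have hij' := (heq i).symm.trans (hij.trans (heq j))
    rw [Point.some.injEq] at hij'
    have eT := hT i
    rw [hij'.1, hij'.2, hT j] at eT
    have eW := hW i
    rw [hij'.1, hij'.2, hW j] at eW
    have hω1 : ω ≠ 1 := by
      rintro rfl
      exact h3 (by linear_combination hω)
    have hprim : IsPrimitiveRoot ω 3 := IsPrimitiveRoot.iff_orderOf.mpr (orderOf_eq_prime hω3 hω1)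
    have hinj : ω ^ (j : ℕ) = ω ^ (i : ℕ) := by
      by_cases hw : w = 0
      · have ht : t ≠ 0 := by
          rintro rfl
          have : (2 : F) ^ 3 * c ≠ 0 := by positivity
          exact this (by rw [hw] at htw; linear_combination -htw)
        have e2 := mul_right_cancel₀ ht eT
        -- Squaring undoes the square, because fourth powers of cube roots of unity are the roots
        -- themselves.
        have e4 : ((ω ^ (j : ℕ)) ^ 2) ^ 2 = ((ω ^ (i : ℕ)) ^ 2) ^ 2 := by rw [e2]
        linear_combination e4 - ω ^ (j : ℕ) * hi j + ω ^ (i : ℕ) * hi i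
      · exact mul_right_cancel₀ hw eW
    exact (Fin.ext (hprim.pow_inj j.2 i.2 hinj)).symm

theorem finite_point [Finite F] (W : WeierstrassCurve.Affine F) : Finite W.Point := by
  refine Finite.of_injective
    (fun P : W.Point => match P with
      | .zero => (none : Option (F × F))
      | .some x y _ => some (x, y)) ?_
  rintro (_ | ⟨x, y, h⟩) (_ | ⟨x', y', h'⟩) H
  · rfl
  · cases H
  · cases H
  · cases H
    rfl

theorem three_mul_le_card_point [Finite F] [DecidableEq F]
    (hk : ∀ a : F, a ≠ 0 → a ^ (3 * k) = 1)
    (hcube : ∀ a : F, a ≠ 0 → a ^ k = 1 → ∃ r, r ^ 3 = a) (h2 : (2 : F) ≠ 0) (h3 : (3 : F) ≠ 0)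
    (hω : ω ^ 2 + ω + 1 = 0) (hc0 : c ≠ 0) (hc1 : c ≠ 1) :
    Nat.card {P : (curveE2 c).toAffine.Point // descentChar k P = 1} * 3 ≤
      Nat.card (curveE2 (1 - c)).toAffine.Point := by
  choose e he hP using fun P : {P : (curveE2 c).toAffine.Point // descentChar k P = 1} =>
    exists_three_threeIsogeny_preimages hk hcube h2 h3 hω hc0 hc1 P.1 P.2
  have h : Nat.card ({P : (curveE2 c).toAffine.Point // descentChar k P = 1} × Fin 3) =
      Nat.card {P : (curveE2 c).toAffine.Point // descentChar k P = 1} * 3 := by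
    rw [Nat.card_prod, Nat.card_fin]
  rw [← h]
  have := finite_point (curveE2 (1 - c)).toAffine
  refine Nat.card_le_card_of_injective (fun p => e p.1 p.2) ?_
  rintro ⟨P, i⟩ ⟨Q, j⟩ hij
  dsimp only at hij
  have hPQ : P = Q := Subtype.ext (by rw [← hP P i, ← hP Q j, hij])
  subst hPQ
  rw [he P hij]

theorem card_point_curveE2_le [Finite F] [DecidableEq F]
    (hk : ∀ a : F, a ≠ 0 → a ^ (3 * k) = 1)
    (hcube : ∀ a : F, a ≠ 0 → a ^ k = 1 → ∃ r, r ^ 3 = a) (h2 : (2 : F) ≠ 0) (h3 : (3 : F) ≠ 0)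
    (hω : ω ^ 2 + ω + 1 = 0) (hc0 : c ≠ 0) (hc1 : c ≠ 1) :
    Nat.card (curveE2 c).toAffine.Point ≤ Nat.card (curveE2 (1 - c)).toAffine.Point :=
  (card_point_le_three_mul hk h2 hc0).trans
    (three_mul_le_card_point hk hcube h2 h3 hω hc0 hc1)

end HessianCover

/-! ### Cubic residues in a finite field and the conclusion -/

theorem curveE1_eq_curveE2 {F : Type*} [Field F] (z : F) : curveE1 z = curveE2 (1 - z) := by
  simp only [curveE1, curveE2, WeierstrassCurve.mk.injEq]
  refine ⟨trivial, ?_, trivial, ?_, ?_⟩ <;> ring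

theorem exists_cube_eq_of_pow_eq_one {F : Type*} [Field F] [Fintype F] {k : ℕ}
    (hk : Fintype.card F - 1 = 3 * k) {a : F} (ha : a ≠ 0) (h : a ^ k = 1) : ∃ r, r ^ 3 = a := by
  classical
  have hk0 : 0 < k := by
    have := Fintype.one_lt_card (α := F)
    omega
  obtain ⟨g, hg⟩ := IsCyclic.exists_generator (α := Fˣ)
  obtain ⟨n, hn : g ^ n = Units.mk0 a ha⟩ := mem_powers_iff_mem_zpowers.mpr (hg (Units.mk0 a ha))
  have hgk : g ^ (n * k) = 1 := by
    rw [pow_mul, hn]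
    ext
    simpa using h
  have hdvd := orderOf_dvd_of_pow_eq_one hgk
  rw [orderOf_eq_card_of_forall_mem_zpowers hg, Nat.card_eq_fintype_card, Fintype.card_units, hk]
    at hdvd
  obtain ⟨m, rfl⟩ := Nat.dvd_of_mul_dvd_mul_right hk0 hdvd
  refine ⟨(g ^ m : Fˣ), ?_⟩
  rw [← Units.val_pow_eq_pow_val, ← pow_mul, mul_comm m, hn, Units.val_mk0]

theorem mainTheorem11 (q : ℕ) [Fact q.Prime] (hq : q ≡ 1 [MOD 3])
    (z : ZMod q) (hz0 : z ≠ 0) (hz1 : z ≠ 1) :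
    numPoints (curveE1 z) = numPoints (curveE2 z) := by
  have hp : q.Prime := Fact.out
  have hmod : q % 3 = 1 := hq
  obtain ⟨k, hk⟩ : ∃ k, q - 1 = 3 * k := ⟨(q - 1) / 3, by omega⟩
  have hcard : Fintype.card (ZMod q) - 1 = 3 * k := by rw [ZMod.card, hk]
  have hpow (a : ZMod q) (ha : a ≠ 0) : a ^ (3 * k) = 1 := by
    rw [← hk]
    exact ZMod.pow_card_sub_one_eq_one ha
  have hcube (a : ZMod q) (ha : a ≠ 0) (h : a ^ k = 1) : ∃ r, r ^ 3 = a :=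
    exists_cube_eq_of_pow_eq_one hcard ha h
  have h2 : (2 : ZMod q) ≠ 0 := by
    intro H
    have := (Nat.prime_dvd_prime_iff_eq hp Nat.prime_two).mp
      ((ZMod.natCast_eq_zero_iff 2 q).mp (by exact_mod_cast H))
    omega
  have h3 : (3 : ZMod q) ≠ 0 := by
    intro H
    have := (Nat.prime_dvd_prime_iff_eq hp Nat.prime_three).mp
      ((ZMod.natCast_eq_zero_iff 3 q).mp (by exact_mod_cast H))
    omega
  obtain ⟨ω, hω⟩ : ∃ ω : ZMod q, ω ^ 2 + ω + 1 = 0 := by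
    obtain ⟨u, hu⟩ := exists_prime_orderOf_dvd_card (G := (ZMod q)ˣ) 3
      (by rw [Fintype.card_units, hcard]; exact dvd_mul_right _ _)
    have hu1 : (u : ZMod q) - 1 ≠ 0 := by
      rw [sub_ne_zero, Ne, Units.val_eq_one]
      rintro rfl
      simp at hu
    have hu3 : (u : ZMod q) ^ 3 = 1 := by
      rw [← Units.val_pow_eq_pow_val, ← hu, pow_orderOf_eq_one, Units.val_one]
    exact ⟨u, mul_left_cancel₀ hu1 (by linear_combination hu3)⟩
  have hz0' : 1 - z ≠ 0 := sub_ne_zero.mpr hz1.symm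
  have hz1' : 1 - z ≠ 1 := by simpa using hz0
  rw [curveE1_eq_curveE2, numPoints, numPoints]
  -- The same inequality serves at `c = z` and at `c = 1 - z`.
  refine le_antisymm ?_ (card_point_curveE2_le hpow hcube h2 h3 hω hz0 hz1)
  simpa using card_point_curveE2_le hpow hcube h2 h3 hω hz0' hz1'
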